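/- For a subset $B$ of $\mathbb{R}^d$ and $\delta>0$, let $N(B,\delta)$ denote the least $j\ge 1$ such that $B$ can be covered by $j$ balls of radius $\delta$. For bounded $B$ let $$\overline{\dim}_{\mathrm B} B := \limsup_{\delta\to 0^+} \frac{\log N(B,\delta)}{-\log\delta}$$ be its upper box-counting dimension, and for arbitrary $B\subset\mathbb{R}^d$ let $$\dim_{\mathrm p} B := \inf\Big\{\sup_{j}\overline{\dim}_{\mathrm B} F_j : B\subset\bigcup_{j\in\mathbb{N}}F_j,\ F_j \subset \mathbb{R}^d \text{ bounded}\Big\}$$ be its packing dimension. Let $S^1=\{e\in\mathbb{R}^2:|e|=1\}$, and for $K\subset\mathbb{R}^2$ and $e\in S^1$ write $K_e:=\{x\cdot e : x\in K\}\subset\mathbb{R}$. Let $\mathcal{H}^1$ denote one-dimensional Hausdorff measure. **Theorem 1.9.** Let $\sigma\in(3/4,1)$. Then there exist a compact set $K\subset\mathbb{R}^2$ with $\mathcal{H}^1(K)>0$ and a number $\tau(\sigma)<1$ such that $$\dim_{\mathrm p}\{e\in S^1 : \dim_{\mathrm p} K_e\le\tau(\sigma)\}\ge\sigma .$$ -/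

import Mathlib

open scoped NNReal ENNReal Topology MeasureTheory

noncomputable section

namespace PackingProj

/-- The Euclidean plane. -/
abbrev Plane : Type := EuclideanSpace ℝ (Fin 2)

/-- `N(B, δ)`: the least `j ≥ 1` such that `B` is covered by `j` closed balls of radius `δ`, centred
at arbitrary points of the ambient space (`⊤` if finitely many never suffice). -/
def coverNum {X : Type*} [PseudoMetricSpace X] (B : Set X) (δ : ℝ≥0) : ℕ∞ :=
  max 1 (Metric.externalCoveringNumber δ B)

/-- Upper box-counting dimension: the upper limit, as `δ → 0+`, of `log N(B, δ) / (- log δ)`. -/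
def upperBoxDim {X : Type*} [PseudoMetricSpace X] (B : Set X) : EReal :=
  Filter.limsup
    (fun δ : ℝ≥0 => ENNReal.log (coverNum B δ : ℝ≥0∞) / ((-Real.log (δ : ℝ) : ℝ) : EReal))
    (𝓝[>] (0 : ℝ≥0))

/-- Packing dimension: the infimum of `sup_j upperBoxDim (F j)` over all countable covers of `B`
by bounded sets `F j`. -/
def packingDim {X : Type*} [PseudoMetricSpace X] (B : Set X) : EReal :=
  ⨅ (F : ℕ → Set X) (_ : ∀ j, Bornology.IsBounded (F j)) (_ : B ⊆ ⋃ j, F j),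
    ⨆ j, upperBoxDim (F j)

/-- `K_e = {x · e : x ∈ K}`, the orthogonal projection of `K` in the direction `e`, as a subset of
the real line. -/
def proj (e : Plane) (K : Set Plane) : Set ℝ :=
  (fun x : Plane => inner ℝ x e) '' K

end PackingProj

end

/-! Choose rapidly growing scales L_{j+1} = L_j n_j^2. Write each digit of t in base n_j^2 as a n_j
+ b with a, b < n_j, and send t to the point (x, y) with x = ∑ a_j n_j / L_{j+1} and y = ∑ b_j n_j /
L_{j+1}. This map has a 4-Lipschitz inverse (`abs_sub_le_expand_digits`), so the closure K of its
image has positive length.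

If θ is within 2 / L_{j+1} of P/q with P ≤ q, then at stage j the n_j^2 digit pairs contribute to x
+ θ y only through the integers q a + P b < 2 q n_j (`exists_finset_near_projection`). For q = L_j^H
and n_j = (2q)^2 this saves a factor 2q in the covering of the projection at scale 1 / L_{j+1}.
Since L_{j+2} is at most a fixed power L_j^A, the saving is a fixed power of δ for every δ between 4
/ L_{j+2} and 4 / L_{j+1}, so the upper box dimension is at most 1 - 1/A
(`externalCoveringNumber_proj_slope_le`).

The slopes θ = ∑ p_j / L_j^H with p_j < L_j^{H-1} have such approximations at every j. They are
parametrised by a product of finite sets. Varying p_k alone, inside any cylinder, gives L_k^{H-1}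
slopes with gaps at least L_k^{-H}, so every open piece has upper box dimension at least σ once H is
large (`le_upperBoxDim_direction_image`). Baire's theorem turns this into a bound for the packing
dimension (`le_packingDim_of_continuous`). -/

namespace PackingProj

open Filter Metric

/-! ### Box and packing dimension: criteria from covering numbers, and Baire category. -/

section Dimension

variable {X : Type*} [PseudoMetricSpace X]

/-- The strict gap `s < τ` absorbs the constant: `C * δ ^ (τ - s)` tends to 0. -/
theorem upperBoxDim_le_of_eventually {B : Set X} {C s τ : ℝ} (hs : 0 ≤ s)
    (hsτ : s < τ)
    (h : ∀ᶠ δ : ℝ≥0 in 𝓝[>] 0,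
      ((externalCoveringNumber δ B : ℕ∞) : ℝ≥0∞) ≤ ENNReal.ofReal (C * (δ : ℝ) ^ (-s))) :
    upperBoxDim B ≤ (τ : EReal) := by
  have hlim : Tendsto (fun δ : ℝ≥0 => C * (δ : ℝ) ^ (τ - s)) (𝓝 0) (𝓝 0) := by
    have h0 : ContinuousAt (fun x : ℝ => C * x ^ (τ - s)) ((0 : ℝ≥0) : ℝ) :=
      (Real.continuousAt_rpow_const _ _ (Or.inr (sub_pos.2 hsτ).le)).const_mul C
    have h1 := h0.tendsto.comp (NNReal.continuous_coe.tendsto 0)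
    simpa [Real.zero_rpow (sub_pos.2 hsτ).ne', Function.comp_def] using h1
  have hev : ∀ᶠ δ : ℝ≥0 in 𝓝[>] 0, C * (δ : ℝ) ^ (τ - s) < 1 :=
    (hlim.eventually (gt_mem_nhds one_pos)).filter_mono nhdsWithin_le_nhds
  have hlt : ∀ᶠ δ : ℝ≥0 in 𝓝[>] 0, δ < 1 :=
    (gt_mem_nhds (zero_lt_one : (0 : ℝ≥0) < 1)).filter_mono nhdsWithin_le_nhds
  refine limsup_le_of_le (by isBoundedDefault) ?_
  filter_upwards [h, hev, hlt, self_mem_nhdsWithin] with δ h1 h2 h3 h4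
  have hδ : (0 : ℝ) < δ := h4
  have hδ1 : (δ : ℝ) < 1 := h3
  have hlog : 0 < -Real.log δ := by have := Real.log_neg hδ hδ1; linarith
  rw [EReal.div_le_iff_le_mul (by exact_mod_cast hlog) (EReal.coe_ne_top _)]
  have hle : ((coverNum B δ : ℕ∞) : ℝ≥0∞) ≤ ENNReal.ofReal ((δ : ℝ) ^ (-τ)) := by
    have hone : (1 : ℝ) ≤ (δ : ℝ) ^ (-τ) :=
      Real.one_le_rpow_of_pos_of_le_one_of_nonpos hδ hδ1.le (by linarith)
    have hmul : C * (δ : ℝ) ^ (-s) ≤ (δ : ℝ) ^ (-τ) := by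
      have : (δ : ℝ) ^ (-s) = (δ : ℝ) ^ (τ - s) * (δ : ℝ) ^ (-τ) := by
        rw [← Real.rpow_add hδ]; ring_nf
      rw [this, ← mul_assoc]
      exact mul_le_of_le_one_left (by positivity) h2.le
    unfold coverNum
    rcases max_choice 1 (externalCoveringNumber δ B) with hm | hm <;> rw [hm]
    · simpa using hone
    · exact h1.trans (ENNReal.ofReal_le_ofReal hmul)
  refine (ENNReal.log_le_log hle).trans ?_
  rw [ENNReal.log_ofReal_of_pos (by positivity), Real.log_rpow hδ, ← EReal.coe_mul,
    EReal.coe_le_coe_iff]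
  linarith

/-- An upper limit is bounded below along any one sequence of scales. -/
theorem le_upperBoxDim_of_tendsto {B : Set X} {s : ℝ} {δ : ℕ → ℝ≥0} (hpos : ∀ k, 0 < δ k)
    (hlim : Tendsto δ atTop (𝓝 0))
    (h : ∀ᶠ k in atTop,
      ENNReal.ofReal ((δ k : ℝ) ^ (-s)) ≤ ((externalCoveringNumber (δ k) B : ℕ∞) : ℝ≥0∞)) :
    (s : EReal) ≤ upperBoxDim B := by
  have hlim' : Tendsto δ atTop (𝓝[>] 0) :=
    tendsto_nhdsWithin_iff.2 ⟨hlim, Eventually.of_forall hpos⟩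
  have hlt : ∀ᶠ k in atTop, δ k < 1 := hlim.eventually (gt_mem_nhds one_pos)
  refine le_limsup_of_frequently_le (hlim'.frequently (Eventually.frequently ?_))
    (by isBoundedDefault)
  filter_upwards [h, hlt] with k h1 h3
  have hδ : (0 : ℝ) < δ k := hpos k
  have hδ1 : (δ k : ℝ) < 1 := h3
  have hlog : 0 < -Real.log (δ k) := by have := Real.log_neg hδ hδ1; linarith
  rw [EReal.le_div_iff_mul_le (by exact_mod_cast hlog) (EReal.coe_ne_top _)]
  have hle : ENNReal.ofReal ((δ k : ℝ) ^ (-s)) ≤ ((coverNum B (δ k) : ℕ∞) : ℝ≥0∞) :=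
    h1.trans (by exact_mod_cast le_max_right _ _)
  refine le_trans ?_ (ENNReal.log_le_log hle)
  rw [ENNReal.log_ofReal_of_pos (by positivity), Real.log_rpow hδ, ← EReal.coe_mul,
    EReal.coe_le_coe_iff]
  linarith

theorem upperBoxDim_mono {A B : Set X} (h : A ⊆ B) : upperBoxDim A ≤ upperBoxDim B := by
  refine limsup_le_limsup ?_ (by isBoundedDefault) (by isBoundedDefault)
  have hlt : ∀ᶠ δ : ℝ≥0 in 𝓝[>] 0, δ < 1 :=
    (gt_mem_nhds (zero_lt_one : (0 : ℝ≥0) < 1)).filter_mono nhdsWithin_le_nhds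
  filter_upwards [hlt, self_mem_nhdsWithin] with δ h3 h4
  have hlog : 0 ≤ -Real.log δ := by
    have := Real.log_neg (show (0 : ℝ) < δ from h4) (show (δ : ℝ) < 1 from h3); linarith
  refine EReal.div_le_div_right_of_nonneg (by exact_mod_cast hlog) (ENNReal.log_le_log ?_)
  exact_mod_cast max_le_max le_rfl (externalCoveringNumber_mono_set h)

theorem externalCoveringNumber_closure_le (δ : ℝ≥0) (B : Set X) :
    externalCoveringNumber δ (closure B) ≤ externalCoveringNumber δ B := by
  refine le_iInf₂ fun C hC => ?_
  rcases C.finite_or_infinite with hf | hi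
  · refine IsCover.externalCoveringNumber_le_encard ?_
    rw [isCover_iff_subset_iUnion_closedBall] at hC ⊢
    exact closure_minimal hC (hf.isClosed_biUnion fun _ _ => isClosed_closedBall)
  · simp [hi.encard_eq]

theorem upperBoxDim_closure (B : Set X) : upperBoxDim (closure B) = upperBoxDim B := by
  unfold upperBoxDim coverNum
  simp_rw [fun δ : ℝ≥0 => le_antisymm (externalCoveringNumber_closure_le δ B)
    (externalCoveringNumber_mono_set subset_closure)]

theorem packingDim_le_upperBoxDim {B : Set X} (hB : Bornology.IsBounded B) :
    packingDim B ≤ upperBoxDim B := by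
  refine (iInf_le _ fun _ => B).trans ((iInf_le _ fun _ => hB).trans ((iInf_le _ ?_).trans ?_))
  · exact Set.subset_iUnion (fun _ : ℕ => B) 0
  · simp

/-- A Baire category lower bound for the packing dimension. -/
theorem le_packingDim_of_continuous {Y : Type*} [TopologicalSpace Y] [BaireSpace Y] [Nonempty Y]
    {φ : Y → X} (hφ : Continuous φ) {E : Set X} (hE : ∀ y, φ y ∈ E) {s : EReal}
    (hs : ∀ U : Set Y, IsOpen U → U.Nonempty → s ≤ upperBoxDim (φ '' U)) :
    s ≤ packingDim E := by
  refine le_iInf fun F => le_iInf fun _ => le_iInf fun hF => ?_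
  -- The preimages of the closures cover `Y`, so one has interior; passing to closures does not
  -- change the upper box dimension.
  obtain ⟨j, hj⟩ := nonempty_interior_of_iUnion_of_closed
    (f := fun j => φ ⁻¹' closure (F j)) (fun j => isClosed_closure.preimage hφ) (by
      refine Set.eq_univ_of_forall fun y => ?_
      obtain ⟨j, hj⟩ := Set.mem_iUnion.1 (hF (hE y))
      exact Set.mem_iUnion.2 ⟨j, subset_closure hj⟩)
  refine le_trans ?_ (le_iSup _ j)
  rw [← upperBoxDim_closure (F j)]
  refine (hs _ isOpen_interior hj).trans (upperBoxDim_mono ?_)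
  exact Set.image_subset_iff.2 interior_subset

theorem le_externalCoveringNumber_of_separated {B : Set X} {δ : ℝ≥0} {m : ℕ} (f : Fin m → X)
    (hf : ∀ i, f i ∈ B) (hsep : ∀ i j, i ≠ j → 2 * (δ : ℝ) < dist (f i) (f j)) :
    (m : ℕ∞) ≤ externalCoveringNumber δ B := by
  refine le_trans ?_ (packingNumber_two_mul_le_externalCoveringNumber δ B)
  have hinj : Function.Injective f := by
    intro i j hij
    by_contra hne
    have h := hsep i j hne
    rw [hij, dist_self] at h
    have := δ.2
    change (0 : ℝ) ≤ (δ : ℝ) at this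
    linarith
  have hS : IsSeparated ((2 * δ : ℝ≥0) : ℝ≥0∞) (Set.range f) := by
    rintro _ ⟨i, rfl⟩ _ ⟨j, rfl⟩ hne
    have h := hsep i j (fun h => hne (by rw [h]))
    rw [edist_nndist, ENNReal.coe_lt_coe, ← NNReal.coe_lt_coe]
    simpa using h
  have hcard : (Set.range f).encard = m := by
    rw [← Set.image_univ, hinj.encard_image, Set.encard_univ]; simp
  rw [← hcard]
  exact IsSeparated.encard_le_packingNumber (Set.range_subset_iff.2 hf) (by simpa using hS)

end Dimension

/-! ### Two tools: refining covers of the line, and series with a telescoping majorant. -/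

theorem externalCoveringNumber_real_le {B : Set ℝ} {S : Finset ℝ} {l : ℝ} {δ : ℝ≥0}
    (hδ : 0 < δ) (hδl : (δ : ℝ) ≤ l) (hB : ∀ b ∈ B, ∃ z ∈ S, |b - z| ≤ l) :
    ((externalCoveringNumber δ B : ℕ∞) : ℝ≥0∞) ≤ ENNReal.ofReal (S.card * (3 * l / δ)) := by
  have hδ' : (0 : ℝ) < δ := hδ
  set m := ⌊2 * l / δ⌋₊ with hm
  set T : Finset ℝ := (S ×ˢ Finset.range (m + 1)).image fun p => p.1 - l + p.2 * δ with hT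
  have hcov : IsCover δ B (T : Set ℝ) := by
    intro b hb
    obtain ⟨z, hz, hbz⟩ := hB b hb
    rw [abs_le] at hbz
    have h0 : 0 ≤ (b - z + l) / δ := div_nonneg (by linarith) hδ'.le
    refine ⟨z - l + (⌊(b - z + l) / δ⌋₊ : ℕ) * δ, ?_, ?_⟩
    · simp only [hT, Finset.coe_image, Set.mem_image, Finset.mem_coe, Finset.mem_product,
        Finset.mem_range]
      refine ⟨(z, ⌊(b - z + l) / δ⌋₊), ⟨hz, ?_⟩, rfl⟩
      refine Nat.lt_succ_of_le (Nat.floor_le_floor ?_)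
      gcongr
      linarith
    · change edist _ _ ≤ _
      rw [edist_nndist, ENNReal.coe_le_coe, ← NNReal.coe_le_coe, coe_nndist, Real.dist_eq, abs_le]
      have h1 := Nat.floor_le h0
      have h2 := Nat.lt_floor_add_one ((b - z + l) / δ)
      rw [le_div_iff₀ hδ'] at h1
      rw [div_lt_iff₀ hδ'] at h2
      constructor <;> nlinarith
  have hcard : (externalCoveringNumber δ B : ℕ∞) ≤ ((S.card * (m + 1) : ℕ) : ℕ∞) := by
    refine hcov.externalCoveringNumber_le_encard.trans ?_
    rw [Set.encard_coe_eq_coe_finsetCard]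
    have := Finset.card_image_le (s := S ×ˢ Finset.range (m + 1))
      (f := fun p : ℝ × ℕ => p.1 - l + p.2 * δ)
    rw [Finset.card_product, Finset.card_range] at this
    exact_mod_cast this
  -- The extra 1 from rounding is at most l / δ, whence 3 in place of 2.
  have hm' : ((m + 1 : ℕ) : ℝ) ≤ 3 * l / δ := by
    have h1 : (m : ℝ) ≤ 2 * l / δ :=
      Nat.floor_le (div_nonneg (by linarith) hδ'.le)
    have h2 : 1 ≤ l / δ := (one_le_div hδ').2 hδl
    push_cast
    have : 3 * l / (δ : ℝ) = 2 * l / δ + l / δ := by ring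
    linarith
  calc ((externalCoveringNumber δ B : ℕ∞) : ℝ≥0∞) ≤ ((S.card * (m + 1) : ℕ) : ℝ≥0∞) := by
        exact_mod_cast (ENat.toENNReal_le.2 hcard)
    _ = ENNReal.ofReal ((S.card * (m + 1) : ℕ) : ℝ) := by rw [ENNReal.ofReal_natCast]
    _ ≤ _ := by
        refine ENNReal.ofReal_le_ofReal ?_
        rw [Nat.cast_mul]
        gcongr

theorem summable_and_tsum_bounds {u w : ℕ → ℝ} (hu : ∀ i, 0 ≤ u i)
    (huw : ∀ i, u i ≤ w i - w (i + 1)) (hw : ∀ i, 0 ≤ w i) :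
    Summable u ∧ ∀ j, ∑ i ∈ Finset.range j, u i ≤ ∑' i, u i ∧
      ∑' i, u i ≤ ∑ i ∈ Finset.range j, u i + w j := by
  have hpart : ∀ j k, ∑ i ∈ Finset.range k, u (i + j) ≤ w j := by
    intro j k
    have h : ∑ i ∈ Finset.range k, u (i + j) ≤ w j - w (k + j) := by
      induction k with
      | zero => simp
      | succ k ih =>
        rw [Finset.sum_range_succ]
        have := huw (k + j)
        rw [show k + 1 + j = k + j + 1 by ring]
        linarith
    linarith [hw (k + j)]
  have hsum : Summable u := summable_of_sum_range_le hu (fun k => by simpa using hpart 0 k)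
  refine ⟨hsum, fun j => ⟨hsum.sum_le_tsum _ fun i _ => hu i, ?_⟩⟩
  rw [← hsum.sum_add_tsum_nat_add j]
  gcongr
  exact Real.tsum_le_of_sum_range_le (fun i => hu _) (hpart j)

/-! ### Splitting digits in a mixed radix system. -/

section Digits

/-- The number whose only nonzero digits, in the mixed radix system with denominators `L`, are
`c j * n j` at the places `j`. -/
noncomputable def expand (L n c : ℕ → ℕ) : ℝ := ∑' j, (c j * n j / L (j + 1) : ℝ)

/-- The truncation of `expand` to the first `j` places. -/
noncomputable def expandTrunc (L n c : ℕ → ℕ) (j : ℕ) : ℝ := ∑ i ∈ Finset.range j, (c i * n i / L (i + 1) : ℝ)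

/-- The digit of `t` at the place `j`, in the mixed radix system with bases `n j ^ 2`. -/
noncomputable def digit (L n : ℕ → ℕ) (t : ℝ) (j : ℕ) : ℕ := ⌊(L (j + 1) : ℝ) * t⌋₊ % n j ^ 2

/-- The quotients of the digits of `t` by the square roots of the bases. -/
noncomputable def digitHi (L n : ℕ → ℕ) (t : ℝ) (j : ℕ) : ℕ := digit L n t j / n j

/-- The remainders of the digits of `t` by the square roots of the bases. -/
noncomputable def digitLo (L n : ℕ → ℕ) (t : ℝ) (j : ℕ) : ℕ := digit L n t j % n j

variable {L n : ℕ → ℕ}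

theorem scale_pos (h0 : L 0 = 1) (hL : ∀ j, L (j + 1) = L j * n j ^ 2) (hn : ∀ j, 2 ≤ n j)
    (j : ℕ) : 0 < L j := by
  induction j with
  | zero => simp [h0]
  | succ j ih => rw [hL]; have := hn j; positivity

theorem expand_bounds (h0 : L 0 = 1) (hL : ∀ j, L (j + 1) = L j * n j ^ 2) (hn : ∀ j, 2 ≤ n j)
    {c : ℕ → ℕ} (hc : ∀ j, c j < n j) (j : ℕ) :
    expandTrunc L n c j ≤ expand L n c ∧ expand L n c ≤ expandTrunc L n c j + 1 / L j := by
  refine (summable_and_tsum_bounds (w := fun j => 1 / (L j : ℝ)) (fun i => by positivity)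
    (fun i => ?_) (fun i => by positivity)).2 j
  have hLi : (0 : ℝ) < L i := by exact_mod_cast scale_pos h0 hL hn i
  have hni : (2 : ℝ) ≤ n i := by exact_mod_cast hn i
  have hci : (c i : ℝ) + 1 ≤ n i := by exact_mod_cast hc i
  have hLL : (L (i + 1) : ℝ) = L i * n i ^ 2 := by exact_mod_cast hL i
  -- Telescoping works since c n ≤ (n - 1) n ≤ n^2 - 1.
  rw [hLL, show (1 : ℝ) / L i - 1 / (L i * n i ^ 2) = (n i ^ 2 - 1) / (L i * n i ^ 2) by
    field_simp]
  gcongr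
  nlinarith

theorem expandTrunc_congr {c c' : ℕ → ℕ} {j : ℕ} (h : ∀ i < j, c i = c' i) :
    expandTrunc L n c j = expandTrunc L n c' j :=
  Finset.sum_congr rfl fun i hi => by rw [h i (Finset.mem_range.1 hi)]

theorem expandTrunc_mem_Icc (h0 : L 0 = 1) (hL : ∀ j, L (j + 1) = L j * n j ^ 2)
    (hn : ∀ j, 2 ≤ n j) {c : ℕ → ℕ} (hc : ∀ j, c j < n j) (j : ℕ) :
    expandTrunc L n c j ∈ Set.Icc 0 1 := by
  refine ⟨Finset.sum_nonneg fun i _ => by positivity, ?_⟩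
  have h1 := (expand_bounds h0 hL hn hc j).1
  have h2 := (expand_bounds h0 hL hn hc 0).2
  simp only [expandTrunc, h0, Finset.range_zero, Finset.sum_empty] at h2
  norm_num at h2
  linarith

/-- The digits used are multiples of `n j`, and the tails beyond place `j` cost at most one unit 1 /
L_{j+1}. -/
theorem abs_expand_sub_ge (h0 : L 0 = 1) (hL : ∀ j, L (j + 1) = L j * n j ^ 2)
    (hn : ∀ j, 2 ≤ n j) {c c' : ℕ → ℕ} (hc : ∀ j, c j < n j) (hc' : ∀ j, c' j < n j) {j : ℕ}
    (h : ∀ i < j, c i = c' i) :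
    n j * |(c j : ℝ) - c' j| - 1 ≤ L (j + 1) * |expand L n c - expand L n c'| := by
  have hLj : (0 : ℝ) < L (j + 1) := by exact_mod_cast scale_pos h0 hL hn (j + 1)
  have h1 := expand_bounds h0 hL hn hc (j + 1)
  have h2 := expand_bounds h0 hL hn hc' (j + 1)
  have h3 := expandTrunc_congr (L := L) (n := n) h
  have e : ∀ c : ℕ → ℕ, expandTrunc L n c (j + 1) =
      expandTrunc L n c j + c j * n j / L (j + 1) := fun c => Finset.sum_range_succ _ _
  have key : |expandTrunc L n c (j + 1) - expandTrunc L n c' (j + 1)| ≤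
      |expand L n c - expand L n c'| + 1 / L (j + 1) := by
    rw [abs_le]
    have a1 := le_abs_self (expand L n c - expand L n c')
    have a2 := neg_abs_le (expand L n c - expand L n c')
    constructor <;> linarith
  have hdiff : expandTrunc L n c (j + 1) - expandTrunc L n c' (j + 1) =
      n j * (c j - c' j) / L (j + 1) := by
    rw [e, e, h3]; ring
  rw [hdiff, abs_div, abs_mul, abs_of_pos hLj, Nat.abs_cast, div_le_iff₀ hLj, add_mul,
    one_div_mul_cancel hLj.ne'] at key
  linarith

theorem floor_scale_succ (hL : ∀ j, L (j + 1) = L j * n j ^ 2) (hn : ∀ j, 2 ≤ n j) (t : ℝ)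
    (j : ℕ) :
    ⌊(L (j + 1) : ℝ) * t⌋₊ = n j ^ 2 * ⌊(L j : ℝ) * t⌋₊ + digit L n t j := by
  have hpos : (n j : ℝ) ≠ 0 := by have := hn j; positivity
  have h : ⌊(L (j + 1) : ℝ) * t⌋₊ / n j ^ 2 = ⌊(L j : ℝ) * t⌋₊ := by
    rw [← Nat.floor_div_natCast, hL]
    push_cast
    congr 1
    field_simp
  rw [← h, digit, Nat.div_add_mod]

theorem digit_eq (t : ℝ) (j : ℕ) :
    digit L n t j = n j * digitHi L n t j + digitLo L n t j := (Nat.div_add_mod _ _).symm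

theorem digitHi_lt (hn : ∀ j, 2 ≤ n j) (t : ℝ) (j : ℕ) : digitHi L n t j < n j := by
  have := hn j
  refine Nat.div_lt_of_lt_mul ?_
  rw [← sq]
  exact Nat.mod_lt _ (by positivity)

theorem digitLo_lt (hn : ∀ j, 2 ≤ n j) (t : ℝ) (j : ℕ) : digitLo L n t j < n j :=
  Nat.mod_lt _ (by have := hn j; omega)

theorem two_pow_le_scale (h0 : L 0 = 1) (hL : ∀ j, L (j + 1) = L j * n j ^ 2)
    (hn : ∀ j, 2 ≤ n j) (j : ℕ) : 2 ^ j ≤ L j := by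
  induction j with
  | zero => simp [h0]
  | succ j ih =>
    rw [hL, pow_succ]
    have := hn j
    exact Nat.mul_le_mul ih (by nlinarith)

theorem exists_first_floor_ne (h0 : L 0 = 1) (hL : ∀ j, L (j + 1) = L j * n j ^ 2)
    (hn : ∀ j, 2 ≤ n j) {s t : ℝ} (hs : s ∈ Set.Ico (0 : ℝ) 1) (ht : t ∈ Set.Ico (0 : ℝ) 1)
    (hst : s ≠ t) :
    ∃ j, ⌊(L (j + 1) : ℝ) * s⌋₊ ≠ ⌊(L (j + 1) : ℝ) * t⌋₊ ∧
      ∀ i ≤ j, ⌊(L i : ℝ) * s⌋₊ = ⌊(L i : ℝ) * t⌋₊ := by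
  classical
  have hex : ∃ j, ⌊(L j : ℝ) * s⌋₊ ≠ ⌊(L j : ℝ) * t⌋₊ := by
    by_contra! hall
    have hd : 0 < |s - t| := abs_pos.2 (sub_ne_zero.2 hst)
    obtain ⟨j, hj⟩ := exists_nat_gt (1 / |s - t|)
    have hjL : (j : ℝ) ≤ L j := by
      exact_mod_cast (Nat.lt_two_pow_self.le.trans (two_pow_le_scale h0 hL hn j))
    have hbig : 1 < L j * |s - t| := by
      rw [div_lt_iff₀ hd] at hj
      nlinarith
    have hLj : (0 : ℝ) ≤ L j := Nat.cast_nonneg _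
    have s1 := Nat.floor_le (mul_nonneg hLj hs.1)
    have s2 := Nat.lt_floor_add_one ((L j : ℝ) * s)
    have t1 := Nat.floor_le (mul_nonneg hLj ht.1)
    have t2 := Nat.lt_floor_add_one ((L j : ℝ) * t)
    rw [hall j] at s1 s2
    rw [← abs_of_nonneg hLj, ← abs_mul, mul_sub] at hbig
    have : |(L j : ℝ) * s - L j * t| < 1 := by
      rw [abs_lt]; constructor <;> linarith
    linarith
  have hz : Nat.find hex ≠ 0 := by
    intro h
    have := Nat.find_spec hex
    rw [h, h0] at this
    simp only [Nat.cast_one, one_mul] at this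
    rw [Nat.floor_eq_zero.2 hs.2, Nat.floor_eq_zero.2 ht.2] at this
    exact this rfl
  obtain ⟨j, hj⟩ := Nat.exists_eq_succ_of_ne_zero hz
  refine ⟨j, by have := Nat.find_spec hex; rwa [hj] at this, fun i hi => ?_⟩
  by_contra hne
  have := Nat.find_min' hex hne
  omega

/-- The map sending a number to the pair of the expansions of its split digits is expanding. -/
theorem abs_sub_le_expand_digits (h0 : L 0 = 1) (hL : ∀ j, L (j + 1) = L j * n j ^ 2)
    (hn : ∀ j, 2 ≤ n j) {s t : ℝ} (hs : s ∈ Set.Ico (0 : ℝ) 1) (ht : t ∈ Set.Ico (0 : ℝ) 1) :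
    |s - t| ≤ 4 * max |expand L n (digitHi L n s) - expand L n (digitHi L n t)|
      |expand L n (digitLo L n s) - expand L n (digitLo L n t)| := by
  rcases eq_or_ne s t with rfl | hst
  · simp
  obtain ⟨j, hne, heq⟩ := exists_first_floor_ne h0 hL hn hs ht hst
  have hdig : ∀ i < j, digit L n s i = digit L n t i := fun i hi => by
    rw [digit, digit, heq (i + 1) hi]
  have hx := abs_expand_sub_ge h0 hL hn (digitHi_lt hn s) (digitHi_lt hn t)
    (fun i hi => by rw [digitHi, digitHi, hdig i hi])
  have hy := abs_expand_sub_ge h0 hL hn (digitLo_lt hn s) (digitLo_lt hn t)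
    (fun i hi => by rw [digitLo, digitLo, hdig i hi])
  have hLj : (0 : ℝ) < L (j + 1) := by exact_mod_cast scale_pos h0 hL hn (j + 1)
  have s1 := Nat.floor_le (mul_nonneg hLj.le hs.1)
  have s2 := Nat.lt_floor_add_one ((L (j + 1) : ℝ) * s)
  have t1 := Nat.floor_le (mul_nonneg hLj.le ht.1)
  have t2 := Nat.lt_floor_add_one ((L (j + 1) : ℝ) * t)
  have es := floor_scale_succ hL hn s j
  have et := floor_scale_succ hL hn t j
  rw [digit_eq] at es et
  rw [← heq j le_rfl] at et
  have as := digitHi_lt (L := L) hn s j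
  have at' := digitHi_lt (L := L) hn t j
  have bs := digitLo_lt (L := L) hn s j
  have bt := digitLo_lt (L := L) hn t j
  rw [es, et] at hne
  rw [es] at s1 s2
  rw [et] at t1 t2
  set x := |expand L n (digitHi L n s) - expand L n (digitHi L n t)|
  set y := |expand L n (digitLo L n s) - expand L n (digitLo L n t)|
  generalize digitHi L n s j = a at *
  generalize digitHi L n t j = a' at *
  generalize digitLo L n s j = b at *
  generalize digitLo L n t j = b' at *
  generalize ⌊(L j : ℝ) * s⌋₊ = T at *
  have hn2 : (2 : ℝ) ≤ n j := by exact_mod_cast hn j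
  push_cast at s1 s2 t1 t2
  have hts : L (j + 1) * |s - t| ≤ n j * |(a : ℝ) - a'| + |(b : ℝ) - b'| + 1 := by
    have en : (n j : ℝ) * |(a : ℝ) - a'| = |(n j : ℝ) * (a - a')| := by
      rw [abs_mul, Nat.abs_cast]
    have el : (L (j + 1) : ℝ) * |s - t| = |(L (j + 1) : ℝ) * (s - t)| := by
      rw [abs_mul, Nat.abs_cast]
    rw [en, el, abs_le]
    have a1 := le_abs_self ((n j : ℝ) * (a - a'))
    have a2 := neg_abs_le ((n j : ℝ) * (a - a'))
    have b1 := le_abs_self ((b : ℝ) - b')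
    have b2 := neg_abs_le ((b : ℝ) - b')
    constructor <;> linarith
  have hmul : ∀ z : ℝ, L (j + 1) * |s - t| ≤ 4 * (L (j + 1) * z) → |s - t| ≤ 4 * z := by
    intro z hz
    refine le_of_mul_le_mul_left ?_ hLj
    linarith
  have hintge : ∀ u v : ℕ, u ≠ v → (1 : ℝ) ≤ |(u : ℝ) - v| := by
    intro u v huv
    have h : (u : ℤ) - v ≠ 0 := sub_ne_zero.2 (by exact_mod_cast huv)
    exact_mod_cast Int.one_le_abs h
  -- The first differing half of the digit decides which coordinate separates the points. With d ≥ 1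
  -- its difference and n ≥ 2, the cases use 4 (n d - 1) ≥ d + 1 and 4 (n d - 1) ≥ n d + n.
  rcases eq_or_ne a a' with rfl | ha
  · have hb : b ≠ b' := fun h => hne (by rw [h])
    have hb1 := hintge b b' hb
    rw [sub_self, abs_zero, mul_zero] at hts
    refine (hmul y ?_).trans (mul_le_mul_of_nonneg_left (le_max_right _ _) (by norm_num))
    nlinarith
  · have ha1 := hintge a a' ha
    have hbb : |(b : ℝ) - b'| + 1 ≤ n j := by
      have h1 : (b : ℝ) + 1 ≤ n j := by exact_mod_cast bs
      have h2 : (b' : ℝ) + 1 ≤ n j := by exact_mod_cast bt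
      have h3 : (0 : ℝ) ≤ b := Nat.cast_nonneg _
      have h4 : (0 : ℝ) ≤ b' := Nat.cast_nonneg _
      have : |(b : ℝ) - b'| ≤ n j - 1 := by rw [abs_le]; constructor <;> linarith
      linarith
    refine (hmul x ?_).trans (mul_le_mul_of_nonneg_left (le_max_left _ _) (by norm_num))
    nlinarith

/-- The possible truncations of pairs of expansions. -/
noncomputable def truncPairs (L n : ℕ → ℕ) : ℕ → Finset (ℝ × ℝ)
  | 0 => {(0, 0)}
  | j + 1 => (truncPairs L n j ×ˢ (Finset.range (n j) ×ˢ Finset.range (n j))).image fun p =>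
      (p.1.1 + p.2.1 * n j / L (j + 1), p.1.2 + p.2.2 * n j / L (j + 1))

theorem card_truncPairs_le (h0 : L 0 = 1) (hL : ∀ j, L (j + 1) = L j * n j ^ 2) (j : ℕ) :
    (truncPairs L n j).card ≤ L j := by
  induction j with
  | zero => simp [truncPairs, h0]
  | succ j ih =>
    refine Finset.card_image_le.trans ?_
    rw [Finset.card_product, Finset.card_product, Finset.card_range, hL, ← sq]
    exact Nat.mul_le_mul_right _ ih

theorem expandTrunc_mem_truncPairs {c c' : ℕ → ℕ} (hc : ∀ j, c j < n j) (hc' : ∀ j, c' j < n j)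
    (j : ℕ) : (expandTrunc L n c j, expandTrunc L n c' j) ∈ truncPairs L n j := by
  induction j with
  | zero => simp [truncPairs, expandTrunc]
  | succ j ih =>
    rw [truncPairs, Finset.mem_image]
    refine ⟨((expandTrunc L n c j, expandTrunc L n c' j), (c j, c' j)), ?_, ?_⟩
    · simp [ih, hc j, hc' j]
    · simp [expandTrunc, Finset.sum_range_succ]

/-- Slopes near a rational number with denominator `q` map the pairs of expansions to a
neighbourhood of few points. -/
theorem exists_finset_near_projection (h0 : L 0 = 1) (hL : ∀ j, L (j + 1) = L j * n j ^ 2)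
    (hn : ∀ j, 2 ≤ n j) (j : ℕ) {P q : ℕ} (hq : 0 < q) (hPq : P ≤ q) {θ : ℝ} (hθ0 : 0 ≤ θ)
    (hθ1 : θ ≤ 1) (hθ : |θ - P / q| ≤ 2 / L (j + 1)) :
    ∃ S : Finset ℝ, S.card ≤ L j * (2 * q * n j) ∧ ∀ c c' : ℕ → ℕ, (∀ j, c j < n j) →
      (∀ j, c' j < n j) →
      ∃ z ∈ S, |expand L n c + θ * expand L n c' - z| ≤ 4 / L (j + 1) := by
  refine ⟨(truncPairs L n j ×ˢ Finset.range (2 * q * n j)).image fun p =>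
    p.1.1 + P / q * p.1.2 + p.2 / q * (n j / L (j + 1)), ?_, ?_⟩
  · refine Finset.card_image_le.trans ?_
    rw [Finset.card_product, Finset.card_range]
    exact Nat.mul_le_mul_right _ (card_truncPairs_le h0 hL j)
  · intro c c' hc hc'
    have hq' : (0 : ℝ) < q := by exact_mod_cast hq
    have e : ∀ c : ℕ → ℕ, expandTrunc L n c (j + 1) =
      expandTrunc L n c j + c j * n j / L (j + 1) := fun c => Finset.sum_range_succ _ _
    -- The error 4 / L_{j+1} is one unit for each of the two tails and two for replacing θ by P/q.
    refine ⟨expandTrunc L n c (j + 1) + P / q * expandTrunc L n c' (j + 1), ?_, ?_⟩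
    · rw [Finset.mem_image]
      refine ⟨((expandTrunc L n c j, expandTrunc L n c' j), q * c j + P * c' j), ?_, ?_⟩
      · rw [Finset.mem_product, Finset.mem_range]
        refine ⟨expandTrunc_mem_truncPairs hc hc' j, ?_⟩
        have h1 : q * c j < q * n j := Nat.mul_lt_mul_of_pos_left (hc j) hq
        have h2 : P * c' j ≤ q * n j := Nat.mul_le_mul hPq (hc' j).le
        simp only
        linarith
      · rw [e, e]
        push_cast
        field_simp
        ring
    · have h1 := expand_bounds h0 hL hn hc (j + 1)
      have h2 := expand_bounds h0 hL hn hc' (j + 1)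
      have h3 := expandTrunc_mem_Icc h0 hL hn hc' (j + 1)
      rw [abs_le] at hθ
      have e4 : (4 : ℝ) / L (j + 1) = 4 * (1 / L (j + 1)) := by ring
      have e2 : (2 : ℝ) / L (j + 1) = 2 * (1 / L (j + 1)) := by ring
      rw [e2] at hθ
      rw [e4]
      have hr : (0 : ℝ) ≤ 1 / L (j + 1) := by positivity
      generalize (1 : ℝ) / L (j + 1) = r at *
      generalize expandTrunc L n c (j + 1) = X at *
      generalize expandTrunc L n c' (j + 1) = Y at *
      generalize expand L n c = x at *
      generalize expand L n c' = y at *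
      generalize (P : ℝ) / q = θ' at *
      have hsplit : x + θ * y - (X + θ' * Y) = (x - X) + θ * (y - Y) + (θ - θ') * Y := by ring
      have k1 : θ * (y - Y) ≤ r := by nlinarith
      have k2 : 0 ≤ θ * (y - Y) := mul_nonneg hθ0 (by linarith)
      have k3 : |(θ - θ') * Y| ≤ 2 * r := by
        rw [abs_mul, abs_of_nonneg h3.1]
        have : |θ - θ'| ≤ 2 * r := abs_le.2 ⟨by linarith, by linarith⟩
        nlinarith [abs_nonneg (θ - θ'), h3.1, h3.2]
      rw [abs_le] at k3
      rw [hsplit, abs_le]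
      constructor <;> linarith

end Digits

/-! ### Directions parametrised by slope. -/

/-- The unit vector of slope `θ` pointing to the right. -/
noncomputable def direction (θ : ℝ) : Plane := (√(1 + θ ^ 2))⁻¹ • !₂[1, θ]

theorem norm_direction (θ : ℝ) : ‖direction θ‖ = 1 := by
  have h : 0 < √(1 + θ ^ 2) := Real.sqrt_pos.2 (by positivity)
  rw [direction, norm_smul, EuclideanSpace.norm_eq, Fin.sum_univ_two]
  simp [abs_of_pos h, h.ne']

theorem continuous_direction : Continuous direction := by
  have hs : Continuous fun θ : ℝ => √(1 + θ ^ 2) := by fun_prop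
  refine Continuous.smul (hs.inv₀ fun θ => ?_) ?_
  · exact (Real.sqrt_pos.2 (by positivity)).ne'
  · refine (PiLp.continuous_toLp 2 _).comp (continuous_pi fun i => ?_)
    fin_cases i <;> simp <;> fun_prop

theorem inner_direction (x : Plane) (θ : ℝ) :
    inner ℝ x (direction θ) = (√(1 + θ ^ 2))⁻¹ * (x 0 + θ * x 1) := by
  rw [direction, inner_smul_right]
  simp [PiLp.inner_apply, Fin.sum_univ_two]

/-- The slope is the ratio of the coordinates, and the first coordinate is at least 1/2 here. -/
theorem abs_sub_le_dist_direction {θ θ' : ℝ} (h0 : 0 ≤ θ) (h1 : θ ≤ 1) (h0' : 0 ≤ θ')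
    (h1' : θ' ≤ 1) : |θ - θ'| ≤ 4 * dist (direction θ) (direction θ') := by
  have e0 : ∀ θ, direction θ 0 = (√(1 + θ ^ 2))⁻¹ := fun θ => by simp [direction]
  have e1 : ∀ θ, direction θ 1 = θ * direction θ 0 := fun θ => by simp [direction, mul_comm]
  have hs : 1 / 2 ≤ direction θ 0 := by
    rw [e0, one_div]
    refine inv_anti₀ (Real.sqrt_pos.2 (by positivity)) (Real.sqrt_le_iff.2 ⟨by norm_num, ?_⟩)
    nlinarith
  have hd : ∀ i, |direction θ i - direction θ' i| ≤ dist (direction θ) (direction θ') := by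
    intro i
    rw [dist_eq_norm]
    exact PiLp.norm_apply_le (direction θ - direction θ') i
  have d0 := hd 0
  have d1 := hd 1
  rw [e1 θ, e1 θ'] at d1
  set a := direction θ 0
  set b := direction θ' 0
  set D := dist (direction θ) (direction θ')
  have h2 : |θ' * (a - b)| ≤ D := by
    rw [abs_mul, abs_of_nonneg h0']
    nlinarith [abs_nonneg (a - b)]
  have h3 : |(θ - θ') * a| ≤ 2 * D := by
    rw [show (θ - θ') * a = (θ * a - θ' * b) - θ' * (a - b) by ring]
    exact (abs_sub _ _).trans (by linarith)
  rw [abs_mul, abs_of_nonneg (by linarith : 0 ≤ a)] at h3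
  nlinarith [abs_nonneg (θ - θ')]

/-! ### The compact set: positive length and coverings of its projections. -/

section Carrier

variable {L n : ℕ → ℕ}

/-- The point of the plane whose coordinates carry the two halves of the digits of `t`. -/
noncomputable def digitPoint (L n : ℕ → ℕ) (t : ℝ) : Plane :=
  !₂[expand L n (digitHi L n t), expand L n (digitLo L n t)]

/-- The closure of the set of digit points. -/
def carrier (L n : ℕ → ℕ) : Set Plane := closure (digitPoint L n '' Set.Ico 0 1)

theorem isCompact_carrier (h0 : L 0 = 1) (hL : ∀ j, L (j + 1) = L j * n j ^ 2)
    (hn : ∀ j, 2 ≤ n j) : IsCompact (carrier L n) := by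
  refine isCompact_of_isClosed_isBounded isClosed_closure (Bornology.IsBounded.closure ?_)
  refine isBounded_iff_forall_norm_le.2 ⟨2, ?_⟩
  rintro _ ⟨t, -, rfl⟩
  have h : ∀ {c : ℕ → ℕ}, (∀ j, c j < n j) → expand L n c ^ 2 ≤ 1 := by
    intro c hc
    have := expand_bounds h0 hL hn hc 0
    simp only [expandTrunc, h0, Finset.range_zero, Finset.sum_empty] at this
    norm_num at this
    nlinarith
  have hx := h (digitHi_lt (L := L) hn t)
  have hy := h (digitLo_lt (L := L) hn t)
  rw [EuclideanSpace.norm_eq, Fin.sum_univ_two]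
  refine Real.sqrt_le_iff.2 ⟨by norm_num, ?_⟩
  simp only [digitPoint, Real.norm_eq_abs, sq_abs]
  simp
  linarith

theorem hausdorffMeasure_carrier_pos (h0 : L 0 = 1) (hL : ∀ j, L (j + 1) = L j * n j ^ 2)
    (hn : ∀ j, 2 ≤ n j) : 0 < μH[1] (carrier L n) := by
  have hanti : AntilipschitzWith 4
      (fun t : Set.Ico (0 : ℝ) 1 => digitPoint L n t) := by
    refine AntilipschitzWith.of_le_mul_dist fun s t => ?_
    refine (abs_sub_le_expand_digits h0 hL hn s.2 t.2).trans ?_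
    have hd : ∀ i, |digitPoint L n s i - digitPoint L n t i| ≤
        dist (digitPoint L n s) (digitPoint L n t) := by
      intro i
      rw [dist_eq_norm]
      exact PiLp.norm_apply_le (digitPoint L n s - digitPoint L n t) i
    have d0 := hd 0
    have d1 := hd 1
    simp only [digitPoint, PiLp.toLp_apply, Matrix.cons_val_zero, Matrix.cons_val_one] at d0 d1
    exact mul_le_mul_of_nonneg_left (max_le d0 d1) (by norm_num)
  have h1 := hanti.le_hausdorffMeasure_image (d := 1) zero_le_one Set.univ
  rw [← isometry_subtype_coe.hausdorffMeasure_image (Or.inl zero_le_one),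
    Set.image_univ, Subtype.range_coe, MeasureTheory.hausdorffMeasure_real] at h1
  have hsub : (fun t : Set.Ico (0 : ℝ) 1 => digitPoint L n t) '' Set.univ ⊆ carrier L n := by
    rintro _ ⟨t, -, rfl⟩
    exact subset_closure ⟨t, t.2, rfl⟩
  refine lt_of_lt_of_le ?_ (MeasureTheory.measure_mono hsub)
  rw [pos_iff_ne_zero]
  intro hz
  rw [hz] at h1
  simp at h1

theorem isBounded_proj (h0 : L 0 = 1) (hL : ∀ j, L (j + 1) = L j * n j ^ 2)
    (hn : ∀ j, 2 ≤ n j) (e : Plane) : Bornology.IsBounded (proj e (carrier L n)) :=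
  ((isCompact_carrier h0 hL hn).image (by fun_prop)).isBounded

theorem externalCoveringNumber_proj_le (h0 : L 0 = 1) (hL : ∀ j, L (j + 1) = L j * n j ^ 2)
    (hn : ∀ j, 2 ≤ n j) (j : ℕ) {P q : ℕ} (hq : 0 < q) (hPq : P ≤ q) {θ : ℝ} (hθ0 : 0 ≤ θ)
    (hθ1 : θ ≤ 1) (hθ : |θ - P / q| ≤ 2 / L (j + 1)) {δ : ℝ≥0} (hδ : 0 < δ)
    (hδL : (δ : ℝ) ≤ 4 / L (j + 1)) :
    ((externalCoveringNumber δ (proj (direction θ) (carrier L n)) : ℕ∞) : ℝ≥0∞) ≤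
      ENNReal.ofReal ((L j * (2 * q * n j) : ℕ) * (3 * (4 / L (j + 1)) / δ)) := by
  obtain ⟨S, hcard, hS⟩ := exists_finset_near_projection h0 hL hn j hq hPq hθ0 hθ1 hθ
  set w : ℝ := (√(1 + θ ^ 2))⁻¹ with hw
  have hw0 : 0 ≤ w := by positivity
  have hw1 : w ≤ 1 := inv_le_one_of_one_le₀ (Real.one_le_sqrt.2 (by nlinarith))
  refine (externalCoveringNumber_real_le (S := S.image (w * ·)) hδ hδL ?_).trans
    (ENNReal.ofReal_le_ofReal ?_)
  · rintro _ ⟨x, hx, rfl⟩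
    -- Being near a finite set is a closed condition, so it passes from digit points to the closure.
    have hclosed : IsClosed {x : Plane | ∃ z ∈ S.image (w * ·),
        |inner ℝ x (direction θ) - z| ≤ 4 / L (j + 1)} := by
      have : {x : Plane | ∃ z ∈ S.image (w * ·),
          |inner ℝ x (direction θ) - z| ≤ 4 / L (j + 1)} = ⋃ z ∈ S.image (w * ·),
          {x : Plane | |inner ℝ x (direction θ) - z| ≤ 4 / L (j + 1)} := by
        ext; simp
      rw [this]
      exact isClosed_biUnion_finset fun z _ => isClosed_le (by fun_prop) continuous_const
    refine closure_minimal ?_ hclosed hx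
    rintro _ ⟨t, -, rfl⟩
    obtain ⟨z, hz, hzt⟩ := hS _ _ (digitHi_lt hn t) (digitLo_lt hn t)
    refine ⟨w * z, Finset.mem_image_of_mem _ hz, ?_⟩
    rw [inner_direction, ← hw, ← mul_sub, abs_mul, abs_of_nonneg hw0]
    refine (mul_le_of_le_one_left (abs_nonneg _) hw1).trans ?_
    simpa [digitPoint] using hzt
  · gcongr
    exact Finset.card_image_le.trans hcard

end Carrier

/-! ### The choice of scales. -/

section Scales

/-- The reciprocals of the scales of the construction. -/
def scale (H : ℕ) : ℕ → ℕ
  | 0 => 1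
  | j + 1 => scale H j * ((2 * scale H j ^ H) ^ 2) ^ 2

/-- The square roots of the bases of the construction. -/
def radix (H j : ℕ) : ℕ := (2 * scale H j ^ H) ^ 2

variable {H : ℕ}

theorem scale_succ (j : ℕ) : scale H (j + 1) = scale H j * radix H j ^ 2 := rfl

theorem one_le_scale (j : ℕ) : 1 ≤ scale H j := by
  induction j with
  | zero => simp [scale]
  | succ j ih => rw [scale]; exact Nat.one_le_iff_ne_zero.2 (by positivity)

theorem two_le_radix (j : ℕ) : 2 ≤ radix H j := by
  have h : 1 ≤ scale H j ^ H := Nat.one_le_pow _ _ (one_le_scale j)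
  unfold radix
  nlinarith

theorem scale_succ' (j : ℕ) : scale H (j + 1) = 16 * scale H j ^ (4 * H + 1) := by
  rw [scale]; ring

theorem scale_dvd_succ (j : ℕ) : scale H j ∣ scale H (j + 1) := Dvd.intro _ rfl

theorem sixteen_le_scale {j : ℕ} (hj : 1 ≤ j) : 16 ≤ scale H j := by
  obtain ⟨i, rfl⟩ := Nat.exists_eq_add_of_le' hj
  rw [scale_succ']
  have h : 1 ≤ scale H i ^ (4 * H + 1) := Nat.one_le_pow _ _ (one_le_scale i)
  omega

/-- One more power of the scale absorbs the factor 16; this needs `1 ≤ j`, as `scale H 0 = 1`. -/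
theorem scale_succ_le_pow {j : ℕ} (hj : 1 ≤ j) :
    scale H (j + 1) ≤ scale H j ^ (4 * H + 2) := by
  rw [scale_succ', pow_succ _ (4 * H + 1), mul_comm]
  exact Nat.mul_le_mul_left _ (sixteen_le_scale hj)

theorem scale_add_two_le_pow {j : ℕ} (hj : 1 ≤ j) :
    scale H (j + 2) ≤ scale H j ^ (4 * H + 2) ^ 2 := by
  rw [sq, pow_mul]
  exact (scale_succ_le_pow (by omega)).trans (Nat.pow_le_pow_left (scale_succ_le_pow hj) _)

theorem two_mul_scale_le_succ (j : ℕ) : 2 * scale H j ≤ scale H (j + 1) := by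
  rw [scale_succ, mul_comm]
  exact Nat.mul_le_mul_left _ (by nlinarith [two_le_radix (H := H) j])

theorem le_scale (j : ℕ) : j ≤ scale H j :=
  Nat.lt_two_pow_self.le.trans (two_pow_le_scale rfl scale_succ two_le_radix j)

end Scales

/-! ### The slopes: many directions, all with small projections. -/

section Slopes

/-- The parameter space of the slopes. -/
abbrev SlopeSpace (H : ℕ) : Type := ∀ j : ℕ, Fin (scale H j ^ (H - 1))

/-- The slope with given numerators over the denominators `scale H j ^ H`. -/
noncomputable def slope {H : ℕ} (p : SlopeSpace H) : ℝ :=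
  ∑' j, (p j : ℕ) / ((scale H j ^ H : ℕ) : ℝ)

variable {H : ℕ}

theorem nonempty_slopeSpace : Nonempty (SlopeSpace H) :=
  ⟨fun j => ⟨0, pow_pos (one_le_scale j) _⟩⟩

theorem slope_term_le (hH : 1 ≤ H) (p : SlopeSpace H) (j : ℕ) :
    (p j : ℕ) / ((scale H j ^ H : ℕ) : ℝ) ≤ 1 / scale H j := by
  have hpos : (0 : ℝ) < scale H j := by exact_mod_cast one_le_scale j
  obtain ⟨K, rfl⟩ := Nat.exists_eq_add_of_le' hH
  have h : ((p j : ℕ) : ℝ) ≤ (scale (K + 1) j : ℝ) ^ K := by exact_mod_cast (p j).2.le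
  rw [Nat.cast_pow, pow_succ, div_le_div_iff₀ (by positivity) hpos]
  nlinarith

theorem inv_scale_le (j : ℕ) :
    1 / (scale H j : ℝ) ≤ 2 / scale H j - 2 / scale H (j + 1) := by
  have hpos : (0 : ℝ) < scale H j := by exact_mod_cast one_le_scale j
  have h : 2 * (scale H j : ℝ) ≤ scale H (j + 1) := by exact_mod_cast two_mul_scale_le_succ j
  have h2 : 2 / (scale H (j + 1) : ℝ) ≤ 2 / (2 * scale H j) := by gcongr
  have e : 2 / (2 * (scale H j : ℝ)) = 1 / scale H j := by field_simp
  have e' : 2 / (scale H j : ℝ) = 2 * (1 / scale H j) := by ring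
  linarith

theorem slope_summable_and_bounds (hH : 1 ≤ H) (p : SlopeSpace H) :
    Summable (fun j => (p j : ℕ) / ((scale H j ^ H : ℕ) : ℝ)) ∧ ∀ j,
      ∑ i ∈ Finset.range j, ((p i : ℕ) / ((scale H i ^ H : ℕ) : ℝ)) ≤ slope p ∧
      slope p ≤ ∑ i ∈ Finset.range j, ((p i : ℕ) / ((scale H i ^ H : ℕ) : ℝ)) +
        2 / scale H j :=
  summable_and_tsum_bounds (w := fun j => 2 / (scale H j : ℝ)) (fun _ => by positivity)
    (fun i => (slope_term_le hH p i).trans (inv_scale_le i)) (fun _ => by positivity)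

theorem slope_mem_Icc (hH : 1 ≤ H) (p : SlopeSpace H) : slope p ∈ Set.Icc 0 1 := by
  refine ⟨tsum_nonneg fun _ => by positivity, ?_⟩
  have h := ((slope_summable_and_bounds hH p).2 1).2
  -- At place 0 the scale is 1, so 0 is the only numerator and the slope is at most 2 / 16.
  have hp : (p 0 : ℕ) = 0 := by
    have := (p 0).2
    simpa [scale] using this
  have hs : (16 : ℝ) ≤ scale H 1 := by exact_mod_cast sixteen_le_scale le_rfl
  have h2 : 2 / (scale H 1 : ℝ) ≤ 2 / 16 := by gcongr
  rw [Finset.sum_range_one, hp] at h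
  norm_num at h h2
  linarith

/-- The scales divide one another, so the last denominator is a common one. -/
theorem exists_slope_truncation (p : SlopeSpace H) (j : ℕ) :
    ∃ P : ℕ, ∑ i ∈ Finset.range (j + 1), ((p i : ℕ) / ((scale H i ^ H : ℕ) : ℝ)) =
      P / ((scale H j ^ H : ℕ) : ℝ) := by
  induction j with
  | zero => exact ⟨p 0, by simp⟩
  | succ j ih =>
    obtain ⟨P, hP⟩ := ih
    obtain ⟨m, hm⟩ := pow_dvd_pow_of_dvd (scale_dvd_succ (H := H) j) H
    have h1 : ((scale H j ^ H : ℕ) : ℝ) ≠ 0 := by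
      have := one_le_scale (H := H) j
      positivity
    have h2 : ((scale H (j + 1) ^ H : ℕ) : ℝ) ≠ 0 := by
      have := one_le_scale (H := H) (j + 1)
      positivity
    refine ⟨P * m + p (j + 1), ?_⟩
    rw [Finset.sum_range_succ, hP, Nat.cast_add, add_div]
    congr 1
    rw [div_eq_div_iff h1 h2, hm]
    push_cast
    ring

theorem continuous_slope (hH : 1 ≤ H) : Continuous (slope (H := H)) := by
  refine continuous_tsum (u := fun j => 1 / (scale H j : ℝ)) (fun j => ?_) ?_ fun j p => ?_
  · exact (continuous_of_discreteTopology
      (f := fun i : Fin (scale H j ^ (H - 1)) => ((i : ℕ) / ((scale H j ^ H : ℕ) : ℝ) : ℝ))).comp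
      (continuous_apply j)
  · exact (summable_and_tsum_bounds (w := fun j => 2 / (scale H j : ℝ)) (fun _ => by positivity)
      inv_scale_le (fun _ => by positivity)).1
  · rw [Real.norm_of_nonneg (by positivity)]
    exact slope_term_le hH p j

theorem slope_update_sub (hH : 1 ≤ H) (p : SlopeSpace H) (k : ℕ)
    (c c' : Fin (scale H k ^ (H - 1))) :
    slope (Function.update p k c) - slope (Function.update p k c') =
      ((c : ℕ) - (c' : ℕ) : ℝ) / ((scale H k ^ H : ℕ) : ℝ) := by
  unfold slope
  rw [← (slope_summable_and_bounds hH _).1.tsum_sub (slope_summable_and_bounds hH _).1,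
    tsum_eq_single k]
  · simp [sub_div]
  · intro i hi
    simp [Function.update_of_ne hi]

theorem le_upperBoxDim_direction_image {σ : ℝ} (hσ1 : σ ≤ 1)
    (hH : 2 ≤ H * (1 - σ)) (U : Set (SlopeSpace H)) (hU : IsOpen U) (hne : U.Nonempty) :
    (σ : EReal) ≤ upperBoxDim ((fun p => direction (slope p)) '' U) := by
  have hH1 : 1 ≤ H := by
    rcases Nat.eq_zero_or_pos H with rfl | h
    · norm_num at hH
    · exact h
  obtain ⟨p, hp⟩ := hne
  obtain ⟨_, ⟨p', n, rfl⟩, hpn, hcyl⟩ :=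
    (PiNat.isTopologicalBasis_cylinders
      (fun j => Fin (scale H j ^ (H - 1)))).exists_subset_of_mem_open hp hU
  rw [← PiNat.mem_cylinder_iff_eq.1 hpn] at hcyl
  -- Slopes differ by at least 1/Q with Q = `scale H k ^ H`, hence directions by at least 1/(4Q),
  -- which exceeds 2δ = 1/(8Q).
  refine le_upperBoxDim_of_tendsto (δ := fun k => (16 * (scale H k : ℝ≥0) ^ H)⁻¹) (fun k => ?_)
    ?_ ?_
  · have := one_le_scale (H := H) k
    positivity
  · refine tendsto_inv_atTop_zero.comp (tendsto_atTop_mono (f := fun k : ℕ => (k : ℝ≥0))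
      (fun k => ?_) tendsto_natCast_atTop_atTop)
    have h1 : k ≤ 16 * scale H k ^ H :=
      (le_scale (H := H) k).trans ((Nat.le_self_pow (by omega) _).trans (Nat.le_mul_of_pos_left _ (by norm_num)))
    exact_mod_cast h1
  · filter_upwards [eventually_ge_atTop (max n 1)] with k hk
    have hkn : n ≤ k := (le_max_left _ _).trans hk
    have hk1 : 1 ≤ k := (le_max_right _ _).trans hk
    have hL16 : (16 : ℝ) ≤ scale H k := by exact_mod_cast sixteen_le_scale hk1
    have hL0 : (0 : ℝ) < scale H k := by linarith
    have hcov : ((scale H k ^ (H - 1) : ℕ) : ℕ∞) ≤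
        externalCoveringNumber ((16 * (scale H k : ℝ≥0) ^ H)⁻¹)
          ((fun p => direction (slope p)) '' U) := by
      refine le_externalCoveringNumber_of_separated
        (fun c => direction (slope (Function.update p k c)))
        (fun c => ⟨_, hcyl (PiNat.cylinder_anti p hkn (PiNat.update_mem_cylinder p k c)), rfl⟩) ?_
      intro c c' hcc
      have hm := slope_mem_Icc hH1 (Function.update p k c)
      have hm' := slope_mem_Icc hH1 (Function.update p k c')
      have h := abs_sub_le_dist_direction hm.1 hm.2 hm'.1 hm'.2
      have hint : (1 : ℝ) ≤ |((c : ℕ) : ℝ) - (c' : ℕ)| := by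
        have h : ((c : ℕ) : ℤ) - (c' : ℕ) ≠ 0 :=
          sub_ne_zero.2 (by exact_mod_cast fun h => hcc (Fin.ext h))
        exact_mod_cast Int.one_le_abs h
      rw [slope_update_sub hH1, abs_div, Nat.abs_cast] at h
      have hQ : (0 : ℝ) < (scale H k : ℝ) ^ H := by positivity
      have h1 : 1 / (scale H k : ℝ) ^ H ≤
          |((c : ℕ) : ℝ) - (c' : ℕ)| / ((scale H k ^ H : ℕ) : ℝ) := by
        push_cast
        gcongr
      push_cast
      rw [mul_inv, ← one_div ((scale H k : ℝ) ^ H)]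
      have : 0 < 1 / (scale H k : ℝ) ^ H := by positivity
      linarith
    have hcov' := ENat.toENNReal_le.2 hcov
    refine le_trans ?_ hcov'
    rw [ENat.toENNReal_coe, ← ENNReal.ofReal_natCast]
    refine ENNReal.ofReal_le_ofReal ?_
    push_cast
    rw [Real.inv_rpow (by positivity), Real.rpow_neg (by positivity), inv_inv,
      Real.mul_rpow (by norm_num) (by positivity), ← Real.rpow_natCast, ← Real.rpow_natCast,
      ← Real.rpow_mul hL0.le, Nat.cast_sub hH1, Nat.cast_one]
    -- Of the two units in `2 ≤ H * (1 - σ)`, one absorbs 16^σ and the other pays for the exponent H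
    -- - 1.
    calc (16 : ℝ) ^ σ * (scale H k : ℝ) ^ (H * σ)
        ≤ (scale H k : ℝ) ^ (1 : ℝ) * (scale H k : ℝ) ^ (H * σ) := by
          gcongr
          refine (Real.rpow_le_rpow_of_exponent_le (by norm_num) hσ1).trans ?_
          rw [Real.rpow_one, Real.rpow_one]
          exact hL16
      _ = (scale H k : ℝ) ^ (1 + H * σ) := (Real.rpow_add hL0 _ _).symm
      _ ≤ (scale H k : ℝ) ^ ((H : ℝ) - 1) :=
          Real.rpow_le_rpow_of_exponent_le (by linarith) (by linarith)

theorem exists_scale_index {δ : ℝ} (hδ : 0 < δ) (hδ1 : δ < 4 / scale H 2) :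
    ∃ j, 1 ≤ j ∧ 4 / (scale H (j + 2) : ℝ) ≤ δ ∧ δ ≤ 4 / scale H (j + 1) := by
  classical
  have hex : ∃ j, 4 / (scale H j : ℝ) ≤ δ := by
    obtain ⟨j, hj⟩ := exists_nat_gt (4 / δ)
    have hjs : (j : ℝ) ≤ scale H j := by exact_mod_cast le_scale j
    have hpos : (0 : ℝ) < scale H j := by exact_mod_cast one_le_scale j
    refine ⟨j, ?_⟩
    rw [div_lt_iff₀ hδ] at hj
    rw [div_le_iff₀ hpos]
    nlinarith
  have hge : 3 ≤ Nat.find hex := by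
    by_contra! hlt
    have h1 := Nat.find_spec hex
    have hmono : scale H (Nat.find hex) ≤ scale H 2 :=
      monotone_nat_of_le_succ (fun j => by
        have := two_mul_scale_le_succ (H := H) j; omega) (by omega)
    have hpos : (0 : ℝ) < scale H (Nat.find hex) := by exact_mod_cast one_le_scale _
    have hmono' : (scale H (Nat.find hex) : ℝ) ≤ scale H 2 := by exact_mod_cast hmono
    have : 4 / (scale H 2 : ℝ) ≤ 4 / scale H (Nat.find hex) := by gcongr
    linarith
  obtain ⟨j, hj⟩ := Nat.exists_eq_add_of_le' hge
  refine ⟨j + 1, by omega, ?_, ?_⟩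
  · have := Nat.find_spec hex
    rwa [hj] at this
  · by_contra! hlt
    have := Nat.find_min' hex hlt.le
    omega

theorem externalCoveringNumber_proj_slope_le (hH : 1 ≤ H) (p : SlopeSpace H) {δ : ℝ≥0}
    (hδ : 0 < δ) (hδ1 : (δ : ℝ) < 4 / scale H 2) :
    ((externalCoveringNumber δ
      (proj (direction (slope p)) (carrier (scale H) (radix H))) : ℕ∞) : ℝ≥0∞) ≤
      ENNReal.ofReal (6 * (δ : ℝ) ^ (-(1 - 1 / ((4 * H + 2) ^ 2 : ℕ) : ℝ))) := by
  have hδ' : (0 : ℝ) < δ := hδ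
  obtain ⟨j, hj, hlow, hup⟩ := exists_scale_index hδ' hδ1
  obtain ⟨P, hP⟩ := exists_slope_truncation p j
  have hb := (slope_summable_and_bounds hH p).2 (j + 1)
  have hm := slope_mem_Icc hH p
  rw [hP] at hb
  have hq : 0 < scale H j ^ H := pow_pos (one_le_scale j) _
  have hq' : (0 : ℝ) < ((scale H j ^ H : ℕ) : ℝ) := by exact_mod_cast hq
  have hPq : P ≤ scale H j ^ H := by
    have h := hb.1.trans hm.2
    rw [div_le_one hq'] at h
    exact_mod_cast h
  refine (externalCoveringNumber_proj_le rfl scale_succ two_le_radix j hq hPq hm.1 hm.2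
    (abs_le.2 ⟨by
      have : (0 : ℝ) ≤ 2 / scale H (j + 1) := by positivity
      linarith, by linarith⟩) hδ hup).trans (ENNReal.ofReal_le_ofReal ?_)
  have hL0 : (0 : ℝ) < scale H j := by exact_mod_cast one_le_scale j
  have hL1 : (1 : ℝ) ≤ scale H j := by exact_mod_cast one_le_scale j
  -- With q = L_j^H and n_j = (2q)^2, the count L_j · 2q n_j is L_{j+1} / (2q).
  have heq : ((scale H j * (2 * scale H j ^ H * radix H j) : ℕ) : ℝ) *
      (3 * (4 / scale H (j + 1)) / δ) = 6 / ((scale H j : ℝ) ^ H * δ) := by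
    rw [scale_succ, radix]
    push_cast
    field_simp
    norm_num
  rw [heq]
  set A : ℕ := (4 * H + 2) ^ 2 with hA
  have hA0 : 0 < A := by positivity
  -- Here δ ≥ 4 / L_{j+2} ≥ L_j^{-A}, so even one factor L_j of the saving is a power of δ.
  have hinv : 1 / (scale H j : ℝ) ≤ (δ : ℝ) ^ (1 / (A : ℝ)) := by
    have h1 : (scale H (j + 2) : ℝ) ≤ (scale H j : ℝ) ^ A := by
      exact_mod_cast scale_add_two_le_pow hj
    have hpos2 : (0 : ℝ) < scale H (j + 2) := by exact_mod_cast one_le_scale _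
    have h2 : (1 / (scale H j : ℝ)) ^ A ≤ δ := by
      rw [one_div_pow]
      calc 1 / (scale H j : ℝ) ^ A ≤ 1 / scale H (j + 2) := by gcongr
        _ ≤ 4 / scale H (j + 2) := by gcongr; norm_num
        _ ≤ δ := hlow
    calc 1 / (scale H j : ℝ) = ((1 / (scale H j : ℝ)) ^ A) ^ (1 / (A : ℝ)) := by
          rw [one_div (A : ℝ), Real.pow_rpow_inv_natCast (by positivity) hA0.ne']
      _ ≤ _ := by gcongr
  calc 6 / ((scale H j : ℝ) ^ H * δ) ≤ 6 / (scale H j * δ) := by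
        gcongr
        exact le_self_pow₀ hL1 (by omega)
    _ = 6 * (1 / (scale H j : ℝ) * (δ : ℝ)⁻¹) := by field_simp
    _ ≤ 6 * ((δ : ℝ) ^ (1 / (A : ℝ)) * (δ : ℝ)⁻¹) := by gcongr
    _ = 6 * (δ : ℝ) ^ (-(1 - 1 / (A : ℝ))) := by
        rw [← Real.rpow_neg_one (δ : ℝ), ← Real.rpow_add hδ']
        ring_nf

theorem packingDim_proj_slope_le (hH : 1 ≤ H) (p : SlopeSpace H) :
    packingDim (proj (direction (slope p)) (carrier (scale H) (radix H))) ≤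
      ((1 - 1 / (2 * ((4 * H + 2) ^ 2 : ℕ)) : ℝ) : EReal) := by
  refine (packingDim_le_upperBoxDim (isBounded_proj rfl scale_succ two_le_radix _)).trans ?_
  have hA : (1 : ℝ) ≤ ((4 * H + 2) ^ 2 : ℕ) := by
    exact_mod_cast Nat.one_le_pow _ _ (by omega)
  refine upperBoxDim_le_of_eventually (C := 6)
    (s := 1 - 1 / ((4 * H + 2) ^ 2 : ℕ)) ?_ ?_ ?_
  · rw [sub_nonneg]
    exact (div_le_one (by linarith)).2 hA
  · have h : (0 : ℝ) < 1 / ((4 * H + 2) ^ 2 : ℕ) := by positivity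
    have e : (1 : ℝ) / (2 * ((4 * H + 2) ^ 2 : ℕ)) = 1 / ((4 * H + 2) ^ 2 : ℕ) / 2 := by ring
    rw [e]
    linarith
  · have hpos : (0 : ℝ≥0) < 4 / scale H 2 := by
      have := one_le_scale (H := H) 2
      positivity
    have hlt : ∀ᶠ δ : ℝ≥0 in 𝓝[>] 0, δ < 4 / scale H 2 :=
      (gt_mem_nhds hpos).filter_mono nhdsWithin_le_nhds
    filter_upwards [hlt, self_mem_nhdsWithin] with δ h1 h2
    exact externalCoveringNumber_proj_slope_le hH p h2 (by exact_mod_cast h1)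

end Slopes

end PackingProj

open PackingProj in
theorem theorem1p9 (σ : ℝ) (hσ : 3 / 4 < σ ∧ σ < 1) :
    ∃ τ : ℝ, τ < 1 ∧ ∃ K : Set PackingProj.Plane,
      IsCompact K ∧
      0 < μH[1] K ∧
      (σ : EReal) ≤ PackingProj.packingDim
        {e : PackingProj.Plane |
          ‖e‖ = 1 ∧ PackingProj.packingDim (PackingProj.proj e K) ≤ (τ : EReal)} := by
  obtain ⟨H, hH⟩ := exists_nat_ge (2 / (1 - σ))
  rw [div_le_iff₀ (by linarith [hσ.2])] at hH
  have hH1 : 1 ≤ H := by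
    rcases Nat.eq_zero_or_pos H with rfl | h
    · norm_num at hH
    · exact h
  -- Halving the gain 1/A leaves room for the constant 6 in the covering bound.
  refine ⟨1 - 1 / (2 * ((4 * H + 2) ^ 2 : ℕ)), sub_lt_self _ (by positivity),
    carrier (scale H) (radix H), isCompact_carrier rfl scale_succ two_le_radix,
    hausdorffMeasure_carrier_pos rfl scale_succ two_le_radix, ?_⟩
  have := nonempty_slopeSpace (H := H)
  exact le_packingDim_of_continuous (φ := fun p : SlopeSpace H => direction (slope p))
    (continuous_direction.comp (continuous_slope hH1))
    (fun p => And.intro (norm_direction _) (packingDim_proj_slope_le hH1 p))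
    (le_upperBoxDim_direction_image hσ.2.le hH)
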